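/- Let $\Sigma=\langle S,F,R\rangle$ be a many-sorted first-order signature, with denumerably many variables of each sort, and let $P$ be a (small) poset. Formulae are built from relation symbols applied to terms by $\top,\bot,\wedge,\vee,\supset,\forall,\exists$; they are taken up to renaming of bound variables, substitution is capture-avoiding, and they are identified with $\lambda$-types over $\Sigma$ (written with $1,0,\times,+,\to,\forall,\exists$). A *Kripke model* $\mathcal K$ on $P$ and $\Sigma$ consists of a **Set**-model of $\Sigma$ at each $p\in P$ (with an inhabited set $A^s_p$ for each sort $s$) and of maps $A^s_{p,q}:A^s_p\to A^s_q$ for $p\le q$, with $A^s_{p,p}=1$ and $A^s_{p,r}=A^s_{q,r}\circ A^s_{p,q}$, which commute with the function symbols and preserve the relations. Forcing $p\Vdash\phi[\vec a]$, with $\vec a$ values in the universe at $p$ for the free variables, is the usual one (clauses for $\top,\bot$, atoms, $\wedge$, $\vee$ and $\exists$ are local at $p$; those for $\supset$ and $\forall$ range over all $q\ge p$), and $\mathcal K\models\phi$ means that $p\Vdash\phi[\vec a]$ for all $p\in P$ and all $\vec a$. A category $\mathbb C$ with a map $M$ from $\lambda$-types to objects is *logically distributive* if $\mathbb C$ has finite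 products, finite coproducts and exponentials; the canonical arrows $(A\times B)+(A\times C)\to A\times(B+C)$ are invertible; $M0$, $M1$, $M(A\times B)$, $M(A+B)$, $M(A\to B)$ are the initial object, the terminal object, the product, the coproduct and the exponential of the respective images; for each variable $x$ of sort $s$, $M(\forall x{:}s.A)$ carries a cone over the family $(M(A[t/x]))_t$, $t$ ranging over the terms of sort $s$, that is terminal among the cones with a vertex of the form $MB$, $x\notin\mathrm{FV}(B)$; dually $M(\exists x{:}s.A)$ carries a cocone that is initial among the cocones with such a vertex; and for $x\notin\mathrm{FV}(A)$ the canonical arrow $M(\exists x{:}s.A\times B)\to MA\times M(\exists x{:}s.B)$ is invertible. Such a pair belongs to $\Sigma\text{-}\mathbf{Str}$ if $\mathbb C$ is small with objects (represented by) $\lambda$-types and $M$ is surjective. A formula $\phi$ is *valid* in $\langle\mathbb C,M\rangle$ if there is an arrow $1\to M\phi$. **Proposition.** For every Kripke model $\mathcal K$ on $P$ and $\Sigma$ there is a logically distributive category $\langle\mathbb K,N\rangle\in\Sigma\text{-}\mathbf{Str}$ such that, for every formula $\phi$, $\mathcal K\models\phi$ if and only if $\phi$ is valid in $\langle\mathbb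 K,N\rangle$. Moreover $\langle\mathbb K,N\rangle$ can be taken to be $\mathrm{LD}(\mathcal K^*)$. Here $\mathcal K^*$ is the associated model in the topos $[P,\mathbf{Set}]$: sorts are interpreted by the functors $p\mapsto A^s_p$, a function symbol by the natural transformation with components its interpretations at the $p\in P$, and a relation symbol $r$ by the arrow into the subobject classifier $\Omega$ that sends $\vec a$ at $p$ to $\{q\ge p : r \text{ holds at } q \text{ of the image of } \vec a\}$; a formula $\phi$ is interpreted as an arrow $[\![\mathrm{FV}(\phi).\phi]\!]$ into $\Omega$ by the standard topos semantics, and is validated by $\mathcal K^*$ when this arrow is $\top$. The category $\mathrm{LD}(\mathcal K^*)$ has as objects the interpretations $N\phi=[\![\mathrm{FV}(\phi).\phi]\!]$ of formulae in their (named) contexts $\mathrm{FV}(\phi)$, at most one arrow between two objects, and an arrow $N\phi\to N\psi$ exactly when $\mathcal K^*$ validates $\phi\supset\psi$. -/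

import Mathlib

open CategoryTheory CategoryTheory.Limits CategoryTheory.MonoidalCategory
  CategoryTheory.CartesianMonoidalCategory

universe v u w

noncomputable section

namespace LogDist

/-! ## First-order many-sorted syntax -/

/-- A logical signature `⟨S, F, R⟩`: sorts, function symbols and relation symbols, every symbol
with its decoration. -/
structure Signature where
  Srt : Type v
  Fn : Type v
  fnArity : Fn → ℕ
  fnDom : (f : Fn) → Fin (fnArity f) → Srt
  fnCod : Fn → Srt
  Rel : Type v
  relArity : Rel → ℕ
  relDom : (r : Rel) → Fin (relArity r) → Srt

variable {L : Signature.{v}}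

/-- The variables: denumerably many for each sort. A variable `x` has sort `x.1`. -/
abbrev Signature.Var (L : Signature.{v}) : Type v := Σ _ : L.Srt, ℕ

/-- `Ix Δ s`: a position of sort `s` in the list `Δ` of the sorts of the quantifiers
that are currently open. -/
inductive Ix {S : Type v} : List S → S → Type v
  | here {Δ : List S} {s : S} : Ix (s :: Δ) s
  | there {Δ : List S} {s t : S} : Ix Δ s → Ix (t :: Δ) s

/-- Weakening of a position by an outer quantifier. -/
def Ix.weaken {S : Type v} {s' : S} : {Δ : List S} → {s : S} → Ix Δ s → Ix (Δ ++ [s']) s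
  | _, _, .here => .here
  | _, _, .there i => .there i.weaken

/-- The position of the outermost quantifier. -/
def Ix.last {S : Type v} {s' : S} : (Δ : List S) → Ix (Δ ++ [s']) s'
  | [] => .here
  | _ :: Δ => .there (Ix.last Δ)

/-- Terms of sort `s`, built from the free (named) variables and the variables bound by the
quantifiers in `Δ` (de Bruijn positions). -/
inductive Term (L : Signature.{v}) (Δ : List L.Srt) : L.Srt → Type v
  | free (x : L.Var) : Term L Δ x.1
  | bound {s : L.Srt} (i : Ix Δ s) : Term L Δ s
  | app (f : L.Fn) (ts : (i : Fin (L.fnArity f)) → Term L Δ (L.fnDom f i)) :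
      Term L Δ (L.fnCod f)

/-- Formulae with bound variables from `Δ`. Free variables are named and bound variables are
de Bruijn positions, so that formulae that differ in the names of bound variables are equal. -/
inductive Formula (L : Signature.{v}) : List L.Srt → Type v
  | top {Δ : List L.Srt} : Formula L Δ
  | bot {Δ : List L.Srt} : Formula L Δ
  | rel {Δ : List L.Srt} (r : L.Rel) (ts : (i : Fin (L.relArity r)) → Term L Δ (L.relDom r i)) :
      Formula L Δ
  | and {Δ : List L.Srt} (A B : Formula L Δ) : Formula L Δ
  | or {Δ : List L.Srt} (A B : Formula L Δ) : Formula L Δ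
  | imp {Δ : List L.Srt} (A B : Formula L Δ) : Formula L Δ
  | all {Δ : List L.Srt} (s : L.Srt) (A : Formula L (s :: Δ)) : Formula L Δ
  | ex {Δ : List L.Srt} (s : L.Srt) (A : Formula L (s :: Δ)) : Formula L Δ

/-- The logical terms of sort `s`. -/
abbrev LTerm (L : Signature.{v}) (s : L.Srt) : Type v := Term L [] s

/-- The logical formulae. The λ-types on the signature are the same expressions written with
`1, 0, ×, +, →, ∀, ∃` for `⊤, ⊥, ∧, ∨, ⊃, ∀, ∃`; the two are identified. -/
abbrev LForm (L : Signature.{v}) : Type v := Formula L []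

open scoped Classical in
/-- The free variables of a term. -/
def Term.fv {Δ : List L.Srt} : {s : L.Srt} → Term L Δ s → Finset L.Var
  | _, .free x => {x}
  | _, .bound _ => ∅
  | _, .app _ ts => Finset.univ.biUnion fun i => (ts i).fv

open scoped Classical in
/-- The free variables of a formula. -/
def Formula.fv : {Δ : List L.Srt} → Formula L Δ → Finset L.Var
  | _, .top => ∅
  | _, .bot => ∅
  | _, .rel _ ts => Finset.univ.biUnion fun i => (ts i).fv
  | _, .and A B => A.fv ∪ B.fv
  | _, .or A B => A.fv ∪ B.fv
  | _, .imp A B => A.fv ∪ B.fv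
  | _, .all _ A => A.fv
  | _, .ex _ A => A.fv

/-- A logical term seen under quantifiers. -/
def Term.lift {Δ : List L.Srt} : {s : L.Srt} → LTerm L s → Term L Δ s
  | _, .free x => .free x
  | _, .app f ts => .app f fun i => (ts i).lift

/-- A substitution of logical terms for variables. -/
abbrev Subst (L : Signature.{v}) : Type v := (x : L.Var) → LTerm L x.1

/-- Substitution on terms. -/
def Term.subst {Δ : List L.Srt} (σ : Subst L) : {s : L.Srt} → Term L Δ s → Term L Δ s
  | _, .free x => (σ x).lift
  | _, .bound i => .bound i
  | _, .app f ts => .app f fun i => (ts i).subst σ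

/-- Capture-avoiding substitution on formulae. -/
def Formula.subst (σ : Subst L) : {Δ : List L.Srt} → Formula L Δ → Formula L Δ
  | _, .top => .top
  | _, .bot => .bot
  | _, .rel r ts => .rel r fun i => (ts i).subst σ
  | _, .and A B => .and (A.subst σ) (B.subst σ)
  | _, .or A B => .or (A.subst σ) (B.subst σ)
  | _, .imp A B => .imp (A.subst σ) (B.subst σ)
  | _, .all s A => .all s (A.subst σ)
  | _, .ex s A => .ex s (A.subst σ)

open scoped Classical in
/-- `A[t/x]`. -/
def Formula.inst {Δ : List L.Srt} (A : Formula L Δ) (x : L.Var) (t : LTerm L x.1) :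
    Formula L Δ :=
  A.subst (Function.update (fun y => .free y) x t)

open scoped Classical in
/-- Binding the variable `x` of a term by an outermost quantifier. -/
def Term.abs (x : L.Var) {Δ : List L.Srt} : {s : L.Srt} → Term L Δ s → Term L (Δ ++ [x.1]) s
  | _, .free y => if h : x = y then h ▸ .bound (Ix.last Δ) else .free y
  | _, .bound i => .bound i.weaken
  | _, .app f ts => .app f fun i => (ts i).abs x

/-- Binding the variable `x` of a formula by an outermost quantifier. -/
def Formula.abs (x : L.Var) : {Δ : List L.Srt} → Formula L Δ → Formula L (Δ ++ [x.1])
  | _, .top => .top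
  | _, .bot => .bot
  | _, .rel r ts => .rel r fun i => (ts i).abs x
  | _, .and A B => .and (A.abs x) (B.abs x)
  | _, .or A B => .or (A.abs x) (B.abs x)
  | _, .imp A B => .imp (A.abs x) (B.abs x)
  | _, .all s A => .all s (A.abs x)
  | _, .ex s A => .ex s (A.abs x)

/-- `∀ x : s. A`, where `s` is the sort of the variable `x`. -/
def Formula.allV (x : L.Var) (A : LForm L) : LForm L := .all x.1 (A.abs x)

/-- `∃ x : s. A`, where `s` is the sort of the variable `x`. -/
def Formula.exV (x : L.Var) (A : LForm L) : LForm L := .ex x.1 (A.abs x)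

theorem Term.subst_eq_self {Δ : List L.Srt} {σ : Subst L} {s : L.Srt} (t : Term L Δ s)
    (h : ∀ y ∈ t.fv, σ y = .free y) : t.subst σ = t := by
  induction t with
  | free x => simp [Term.subst, h x (by simp [Term.fv]), Term.lift]
  | bound i => rfl
  | app f ts ih =>
    simp only [Term.subst]
    congr 1
    funext i
    exact ih i fun y hy => h y (by simpa [Term.fv] using ⟨i, hy⟩)

theorem Formula.subst_eq_self {σ : Subst L} {Δ : List L.Srt} (A : Formula L Δ)
    (h : ∀ y ∈ A.fv, σ y = .free y) : A.subst σ = A := by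
  induction A with
  | top => rfl
  | bot => rfl
  | rel r ts =>
    simp only [Formula.subst]
    congr 1
    funext i
    exact Term.subst_eq_self _ fun y hy => h y (by simpa [Formula.fv] using ⟨i, hy⟩)
  | and A B ihA ihB | or A B ihA ihB | imp A B ihA ihB =>
    simp only [Formula.subst]
    rw [ihA fun y hy => h y (by simp [Formula.fv, hy]),
      ihB fun y hy => h y (by simp [Formula.fv, hy])]
  | all s A ih | ex s A ih =>
    simp only [Formula.subst]
    rw [ih fun y hy => h y (by simpa [Formula.fv] using hy)]

open scoped Classical in
theorem Formula.inst_eq_self {A : LForm L} {x : L.Var} (t : LTerm L x.1) (hx : x ∉ A.fv) :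
    A.inst x t = A :=
  A.subst_eq_self fun y hy =>
    Function.update_of_ne (show y ≠ x from fun e => hx (e ▸ hy)) _ _

/-! ## Logically distributive categories -/

/-- `ev : A × E ⟶ B` exhibits `E` as the exponential object `B ^ A`. -/
def IsExponential {C : Type u} [Category.{w} C] [HasFiniteProducts C] {A B E : C}
    (ev : A ⨯ E ⟶ B) : Prop :=
  ∀ (X : C) (f : A ⨯ X ⟶ B), ∃! g : X ⟶ E, prod.map (𝟙 A) g ≫ ev = f

/-- A category `C` with a map `M` from the λ-types to its objects is logically distributive.
The functor `Σ_A(x)` sends a logical term `t` of the sort of `x`, as an object of a discrete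
category, to `M (A[t/x])`; a cone over it is a family of arrows indexed by these terms, and the
cones that count are those with a vertex `M B` such that `x` is not free in `B`. -/
structure LogicallyDistributive (C : Type u) [Category.{w} C] (M : LForm L → C) where
  [products : HasFiniteProducts C]
  [coproducts : HasFiniteCoproducts C]
  exponentials : ∀ A B : C, ∃ (E : C) (ev : A ⨯ E ⟶ B), IsExponential ev
  /-- The canonical arrow `(A × B) + (A × B') ⟶ A × (B + B')` is invertible. -/
  distributive : ∀ A B B' : C,
    IsIso (coprod.desc (prod.map (𝟙 A) (coprod.inl : B ⟶ B ⨿ B'))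
      (prod.map (𝟙 A) (coprod.inr : B' ⟶ B ⨿ B')))
  /-- `M 0` is initial. -/
  zero : IsInitial (M .bot)
  /-- `M 1` is terminal. -/
  one : IsTerminal (M .top)
  /-- `M (A × B)` is the product of `M A` and `M B`. -/
  fst : ∀ A B, M (.and A B) ⟶ M A
  snd : ∀ A B, M (.and A B) ⟶ M B
  isProduct : ∀ A B, IsLimit (BinaryFan.mk (fst A B) (snd A B))
  /-- `M (A + B)` is the coproduct of `M A` and `M B`. -/
  inl : ∀ A B, M A ⟶ M (.or A B)
  inr : ∀ A B, M B ⟶ M (.or A B)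
  isCoproduct : ∀ A B, IsColimit (BinaryCofan.mk (inl A B) (inr A B))
  /-- `M (A → B)` is the exponential `(M B) ^ (M A)`. -/
  ev : ∀ A B, M A ⨯ M (.imp A B) ⟶ M B
  isExponential : ∀ A B, IsExponential (ev A B)
  /-- `M (∀ x. A)` is the vertex of a cone over `Σ_A(x)`, and this cone is terminal among the
  cones over `Σ_A(x)` with a vertex `M B`, `x` not free in `B`. -/
  allE : ∀ (x : L.Var) (A : LForm L) (t : LTerm L x.1), M (A.allV x) ⟶ M (A.inst x t)
  isTerminalAll : ∀ (x : L.Var) (A B : LForm L), x ∉ B.fv →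
    ∀ c : (t : LTerm L x.1) → (M B ⟶ M (A.inst x t)),
      ∃! h : M B ⟶ M (A.allV x), ∀ t, h ≫ allE x A t = c t
  /-- `M (∃ x. A)` is the vertex of a cocone over `Σ_A(x)`, and this cocone is initial among the
  cocones over `Σ_A(x)` with a vertex `M B`, `x` not free in `B`. -/
  exI : ∀ (x : L.Var) (A : LForm L) (t : LTerm L x.1), M (A.inst x t) ⟶ M (A.exV x)
  isInitialEx : ∀ (x : L.Var) (A B : LForm L), x ∉ B.fv →
    ∀ c : (t : LTerm L x.1) → (M (A.inst x t) ⟶ M B),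
      ∃! h : M (A.exV x) ⟶ M B, ∀ t, exI x A t ≫ h = c t
  /-- For `x` not free in `A`, the arrow `M (∃ x. A × B) ⟶ M A × M (∃ x. B)` of cocones over
  `Σ_{A × B}(x)` is invertible, the cocone on the right being `{1 × δ_t}` with `δ` that of
  `M (∃ x. B)`. -/
  frobenius : ∀ (x : L.Var) (A B : LForm L) (hx : x ∉ A.fv),
    ∃ h : M ((Formula.and A B).exV x) ⟶ M (.and A (B.exV x)),
      (∀ t : LTerm L x.1,
        exI x (.and A B) t ≫ h ≫ fst A (B.exV x) =
            fst (A.inst x t) (B.inst x t) ≫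
              eqToHom (congrArg M (Formula.inst_eq_self t hx)) ∧
          exI x (.and A B) t ≫ h ≫ snd A (B.exV x) =
            snd (A.inst x t) (B.inst x t) ≫ exI x B t) ∧
      IsIso h

/-- An object `⟨𝔻, N⟩` of `Σ-Str`: a (small) logically distributive category with
`Obj 𝔻 ⊆ λTypes(Σ)` and with `N` surjective. -/
structure SigmaStr (L : Signature.{v}) where
  Obj : Set (LForm L)
  [category : Category.{v} Obj]
  N : LForm L → Obj
  surjective : Function.Surjective N
  logicallyDistributive : LogicallyDistributive (L := L) Obj N

attribute [instance] SigmaStr.category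

instance (D : SigmaStr L) : HasFiniteProducts D.Obj := D.logicallyDistributive.products

/-- A formula `φ` is valid in `⟨𝔻, N⟩` when there is an arrow `1 ⟶ N φ`. -/
def SigmaStr.Valid (D : SigmaStr L) (φ : LForm L) : Prop :=
  Nonempty (⊤_ D.Obj ⟶ D.N φ)

/-! ## Models in an elementary topos -/

section Topos

variable {E : Type u} [Category.{w} E] [CartesianMonoidalCategory E] [BraidedCategory E]
  [MonoidalClosed E] [HasFiniteLimits E] [HasFiniteColimits E] [HasImages E]
  (𝒯 : Subobject.Classifier E)

/-- `⊤_a : a ⟶ 1 ⟶ Ω`. -/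
def trueAt (a : E) : a ⟶ 𝒯.Ω := 𝒯.χ₀ a ≫ 𝒯.truth

/-- `⊥_a : a ⟶ 1 ⟶ Ω`, where `1 ⟶ Ω` is the character of `0 ⟶ 1`. -/
def falseAt (a : E) : a ⟶ 𝒯.Ω :=
  haveI : Mono (initial.to (𝟙_ E)) := initial_mono (𝟙_ E) initialIsInitial
  toUnit a ≫ 𝒯.χ (initial.to (𝟙_ E))

/-- `∩ : Ω × Ω ⟶ Ω`, the character of `(⊤, ⊤) : 1 ⟶ Ω × Ω`. -/
def andΩ : 𝒯.Ω ⊗ 𝒯.Ω ⟶ 𝒯.Ω :=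
  haveI : Mono (lift 𝒯.truth 𝒯.truth) := 𝒯.isTerminalΩ₀.mono_from _
  𝒯.χ (lift 𝒯.truth 𝒯.truth)

/-- `∪ : Ω × Ω ⟶ Ω`, the character of the image of `[(⊤_Ω, 1_Ω), (1_Ω, ⊤_Ω)]`. -/
def orΩ : 𝒯.Ω ⊗ 𝒯.Ω ⟶ 𝒯.Ω :=
  𝒯.χ (image.ι (coprod.desc (lift (trueAt 𝒯 𝒯.Ω) (𝟙 𝒯.Ω)) (lift (𝟙 𝒯.Ω) (trueAt 𝒯 𝒯.Ω))))

/-- `⇒ : Ω × Ω ⟶ Ω`, the character of the equaliser of `∩` and the first projection. -/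
def impΩ : 𝒯.Ω ⊗ 𝒯.Ω ⟶ 𝒯.Ω :=
  𝒯.χ (equalizer.ι (andΩ 𝒯) (fst 𝒯.Ω 𝒯.Ω))

/-- `∀_a : Ω ^ a ⟶ Ω`, the character of the transpose `1 ⟶ Ω ^ a` of `a × 1 ⟶ a ⟶ Ω`, the
last arrow being `⊤_a`. -/
def allΩ (a : E) : (ihom a).obj 𝒯.Ω ⟶ 𝒯.Ω :=
  haveI : Mono (MonoidalClosed.curry (fst a 𝒯.Ω₀ ≫ trueAt 𝒯 a)) :=
    𝒯.isTerminalΩ₀.mono_from _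
  𝒯.χ (MonoidalClosed.curry (fst a 𝒯.Ω₀ ≫ trueAt 𝒯 a))

/-- The subobject of `a × Ω ^ a` whose character is the evaluation `a × Ω ^ a ⟶ Ω`. -/
def memΩ (a : E) :
    pullback ((ihom.ev a).app 𝒯.Ω) 𝒯.truth ⟶ a ⊗ (ihom a).obj 𝒯.Ω :=
  pullback.fst ((ihom.ev a).app 𝒯.Ω) 𝒯.truth

/-- `∃_a : Ω ^ a ⟶ Ω`, the character of the image of that subobject under the projection to
`Ω ^ a`. -/
def exΩ (a : E) : (ihom a).obj 𝒯.Ω ⟶ 𝒯.Ω :=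
  𝒯.χ (image.ι (memΩ 𝒯 a ≫ snd a ((ihom a).obj 𝒯.Ω)))

/-- The data of an interpretation of the signature in the topos `E`. -/
structure ToposModel (L : Signature.{v}) where
  srt : L.Srt → E
  fn : (f : L.Fn) → (∏ᶜ (fun i => srt (L.fnDom f i)) ⟶ srt (L.fnCod f))
  rel : (r : L.Rel) → (∏ᶜ (fun i => srt (L.relDom r i)) ⟶ 𝒯.Ω)

namespace ToposModel

variable {𝒯} (U : ToposModel 𝒯 L)

/-- The object `M A₁ × ⋯ × M Aₙ` of a context: a finite set `Γ` of variables, extended by the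
variables bound by the open quantifiers. -/
def ctx (Γ : Finset L.Var) : List L.Srt → E
  | [] => ∏ᶜ fun x : Γ => U.srt x.1.1
  | s :: Δ => U.srt s ⊗ ctx Γ Δ

/-- The projection to a free variable. -/
def projFree (Γ : Finset L.Var) (x : Γ) : (Δ : List L.Srt) → (U.ctx Γ Δ ⟶ U.srt x.1.1)
  | [] => Pi.π (fun x : Γ => U.srt x.1.1) x
  | s :: Δ => snd (U.srt s) (U.ctx Γ Δ) ≫ projFree Γ x Δ

/-- The projection to a bound variable. -/
def projBound (Γ : Finset L.Var) :
    {Δ : List L.Srt} → {s : L.Srt} → Ix Δ s → (U.ctx Γ Δ ⟶ U.srt s)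
  | s :: Δ, _, .here => fst (U.srt s) (U.ctx Γ Δ)
  | s :: Δ, _, .there i => snd (U.srt s) (U.ctx Γ Δ) ≫ projBound Γ i

/-- The interpretation of a term in context. -/
def termInterp (Γ : Finset L.Var) {Δ : List L.Srt} :
    {s : L.Srt} → (t : Term L Δ s) → t.fv ⊆ Γ → (U.ctx Γ Δ ⟶ U.srt s)
  | _, .free x, h => U.projFree Γ ⟨x, h (by simp [Term.fv])⟩ Δ
  | _, .bound i, _ => U.projBound Γ i
  | _, .app f ts, h =>
    Pi.lift (fun i => termInterp Γ (ts i) fun _ hy =>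
      h (by simpa [Term.fv] using ⟨i, hy⟩)) ≫ U.fn f

/-- The interpretation `⟦Γ. φ⟧` of a formula in context. -/
def interp (Γ : Finset L.Var) :
    {Δ : List L.Srt} → (φ : Formula L Δ) → φ.fv ⊆ Γ → (U.ctx Γ Δ ⟶ 𝒯.Ω)
  | _, .top, _ => trueAt 𝒯 _
  | _, .bot, _ => falseAt 𝒯 _
  | _, .rel r ts, h =>
    Pi.lift (fun i => U.termInterp Γ (ts i) fun _ hy =>
      h (by simpa [Formula.fv] using ⟨i, hy⟩)) ≫ U.rel r
  | _, .and A B, h =>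
    lift (interp Γ A fun _ hy => h (by simp [Formula.fv, hy]))
      (interp Γ B fun _ hy => h (by simp [Formula.fv, hy])) ≫ andΩ 𝒯
  | _, .or A B, h =>
    lift (interp Γ A fun _ hy => h (by simp [Formula.fv, hy]))
      (interp Γ B fun _ hy => h (by simp [Formula.fv, hy])) ≫ orΩ 𝒯
  | _, .imp A B, h =>
    lift (interp Γ A fun _ hy => h (by simp [Formula.fv, hy]))
      (interp Γ B fun _ hy => h (by simp [Formula.fv, hy])) ≫ impΩ 𝒯
  | Δ, .all s A, h =>
    MonoidalClosed.curry (A := U.srt s) (Y := U.ctx Γ Δ) (interp Γ A h) ≫ allΩ 𝒯 (U.srt s)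
  | Δ, .ex s A, h =>
    MonoidalClosed.curry (A := U.srt s) (Y := U.ctx Γ Δ) (interp Γ A h) ≫ exΩ 𝒯 (U.srt s)

/-- `⟦FV(φ). φ⟧`, together with the context `FV(φ)`. -/
def sem (φ : LForm L) : Σ Γ : Finset L.Var, (U.ctx Γ [] ⟶ 𝒯.Ω) :=
  ⟨φ.fv, U.interp φ.fv φ (Finset.Subset.refl _)⟩

/-- The model validates `φ`: `⟦FV(φ). φ⟧ = ⊤`. -/
def Validates (φ : LForm L) : Prop :=
  U.interp φ.fv φ (Finset.Subset.refl _) = trueAt 𝒯 (U.ctx φ.fv [])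

end ToposModel

variable {𝒯} in
/-- `⟨𝔻, N⟩` is `LD(𝒰)`, the category associated with the model `𝒰`: its objects are the
interpretations `N φ = ⟦FV(φ). φ⟧` of formulae in context (represented by formulae); there is at
most one arrow between two objects, and there is one from `N φ` to `N ψ` precisely when `𝒰`
validates `φ ⊃ ψ`. -/
structure SigmaStr.IsLD (D : SigmaStr L) (U : ToposModel 𝒯 L) : Prop where
  obj_eq_iff : ∀ φ ψ : LForm L, D.N φ = D.N ψ ↔ U.sem φ = U.sem ψ
  subsingleton_hom : ∀ X Y : D.Obj, Subsingleton (X ⟶ Y)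
  nonempty_hom_iff : ∀ φ ψ : LForm L, Nonempty (D.N φ ⟶ D.N ψ) ↔ U.Validates (.imp φ ψ)

end Topos

/-! ## Kripke models -/

/-- A **Set**-model on the signature: inhabited sets, functions and relations. -/
structure SetModel (L : Signature.{v}) where
  dom : L.Srt → Type u
  nonempty : ∀ s, Nonempty (dom s)
  fn : (f : L.Fn) → ((i : Fin (L.fnArity f)) → dom (L.fnDom f i)) → dom (L.fnCod f)
  rel : (r : L.Rel) → ((i : Fin (L.relArity r)) → dom (L.relDom r i)) → Prop

/-- A Kripke model on the poset `P`: a **Set**-model at every `p`, and for `p ≤ q` a map of the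
universes, functorial in `p ≤ q`, that commutes with the interpretation of the function symbols
and preserves the relations. -/
structure KripkeModel (L : Signature.{v}) (P : Type u) [PartialOrder P] where
  model : P → SetModel.{v, u} L
  map : {p q : P} → p ≤ q → (s : L.Srt) → (model p).dom s → (model q).dom s
  map_refl : ∀ (p : P) (s : L.Srt) (a : (model p).dom s), map (le_refl p) s a = a
  map_trans : ∀ {p q r : P} (h : p ≤ q) (h' : q ≤ r) (s : L.Srt) (a : (model p).dom s),
    map (h.trans h') s a = map h' s (map h s a)
  map_fn : ∀ {p q : P} (h : p ≤ q) (f : L.Fn) (a),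
    map h _ ((model p).fn f a) = (model q).fn f fun i => map h _ (a i)
  map_rel : ∀ {p q : P} (h : p ≤ q) (r : L.Rel) (a),
    (model p).rel r a → (model q).rel r fun i => map h _ (a i)

namespace SetModel

variable (A : SetModel.{v, u} L)

/-- An assignment of values to the free variables. -/
abbrev Assignment : Type (max u v) := (x : L.Var) → A.dom x.1

/-- Values for the variables bound by the open quantifiers. -/
abbrev Env (Δ : List L.Srt) : Type (max u v) := (s : L.Srt) → Ix Δ s → A.dom s

variable {A}

/-- No quantifier is open. -/
def Env.nil : A.Env [] := fun _ i => nomatch i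

/-- A value for one more bound variable. -/
def Env.cons {Δ : List L.Srt} {s : L.Srt} (a : A.dom s) (e : A.Env Δ) : A.Env (s :: Δ)
  | _, .here => a
  | _, .there i => e _ i

/-- The value of a term. -/
def eval (v : A.Assignment) {Δ : List L.Srt} (e : A.Env Δ) :
    {s : L.Srt} → Term L Δ s → A.dom s
  | _, .free x => v x
  | _, .bound i => e _ i
  | _, .app f ts => A.fn f fun i => eval v e (ts i)

end SetModel

namespace KripkeModel

variable {P : Type u} [PartialOrder P] (K : KripkeModel.{v, u} L P)

/-- `φ` holds at `p` for given values (in the universe at `p`) of its variables. -/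
def Forces : {Δ : List L.Srt} → (p : P) → (K.model p).Assignment → (K.model p).Env Δ →
    Formula L Δ → Prop
  | _, _, _, _, .top => True
  | _, _, _, _, .bot => False
  | _, p, v, e, .rel r ts => (K.model p).rel r fun i => SetModel.eval v e (ts i)
  | _, p, v, e, .and A B => Forces p v e A ∧ Forces p v e B
  | _, p, v, e, .or A B => Forces p v e A ∨ Forces p v e B
  | _, p, v, e, .imp A B => ∀ (q : P) (h : p ≤ q),
      Forces q (fun x => K.map h _ (v x)) (fun _ i => K.map h _ (e _ i)) A →
        Forces q (fun x => K.map h _ (v x)) (fun _ i => K.map h _ (e _ i)) B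
  | _, p, v, e, .all s A => ∀ (q : P) (h : p ≤ q) (a : (K.model q).dom s),
      Forces q (fun x => K.map h _ (v x))
        (SetModel.Env.cons a fun _ i => K.map h _ (e _ i)) A
  | _, p, v, e, .ex s A => ∃ a : (K.model p).dom s, Forces p v (SetModel.Env.cons a e) A

/-- `φ` is valid at `p`: it holds at `p` for all values of its free variables. -/
def ValidAt (p : P) (φ : LForm L) : Prop :=
  ∀ v : (K.model p).Assignment, K.Forces p v SetModel.Env.nil φ

/-- `φ` is valid in the Kripke model. -/
def Valid (φ : LForm L) : Prop := ∀ p : P, K.ValidAt p φ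

end KripkeModel

/-! ## The associated model in the topos of presheaves -/

section Presheaf

variable (P : Type u) [PartialOrder P]

/-- The functor `Ω : P ⥤ Set` of the upward closed subsets of `{q | p ≤ q}`. -/
def upΩ : P ⥤ Type u where
  obj p := {S : Set P // S ⊆ Set.Ici p ∧ IsUpperSet S}
  map {p q} _ := ↾fun S => ⟨S.1 ∩ Set.Ici q, Set.inter_subset_right,
    S.2.2.inter (isUpperSet_Ici q)⟩
  map_id p := by
    ext S : 3
    exact Subtype.ext (Set.inter_eq_left.2 S.2.1)
  map_comp {p q r} f g := by
    ext S : 3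
    refine Subtype.ext (Set.ext fun x => ?_)
    exact ⟨fun h => ⟨⟨h.1, (leOfHom g).trans h.2⟩, h.2⟩, fun h => ⟨h.1.1, h.2⟩⟩

/-- The truth arrow, with the value `{q | p ≤ q}` at `p`. -/
def upTruth : (Functor.const P).obj PUnit.{u + 1} ⟶ upΩ P where
  app p := ↾fun _ => ⟨Set.Ici p, subset_rfl, isUpperSet_Ici p⟩
  naturality p q f := by
    ext
    exact Subtype.ext (Set.inter_eq_right.2 (Set.Ici_subset_Ici.2 (leOfHom f))).symm

variable {P}

/-- The character of a subfunctor. -/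
def upχ {F G : P ⥤ Type u} (m : F ⟶ G) : G ⟶ upΩ P where
  app p := ↾fun x => ⟨{q | ∃ (h : p ≤ q) (a : F.obj q), G.map (homOfLE h) x = m.app q a},
    fun _ hq => hq.1, by
      rintro q r hqr ⟨h, a, ha⟩
      refine ⟨h.trans hqr, F.map (homOfLE hqr) a, ?_⟩
      have := NatTrans.naturality_apply m (homOfLE hqr) a
      rw [this, ← ha, ← Functor.map_comp_apply]
      rfl⟩
  naturality p q f := by
    ext x
    refine Subtype.ext (Set.ext fun r => ?_)
    constructor
    · rintro ⟨h, a, ha⟩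
      refine ⟨⟨(leOfHom f).trans h, a, ?_⟩, h⟩
      rw [← ha]
      exact Functor.map_comp_apply G f (homOfLE h) x
    · rintro ⟨⟨h, a, ha⟩, h'⟩
      refine ⟨h', a, ?_⟩
      rw [← ha]
      exact (Functor.map_comp_apply G f (homOfLE h') x).symm

theorem isPullback_upχ {F G : P ⥤ Type u} (m : F ⟶ G) [Mono m] :
    IsPullback m ((Functor.isTerminalConst P Types.isTerminalPUnit).from F) (upχ m)
      (upTruth P) := by
  refine IsPullback.of_forall_isPullback_app fun p => ?_
  rw [Types.isPullback_iff]
  refine ⟨?_, ?_, ?_⟩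
  · ext x : 3
    refine Subtype.ext (Set.ext fun q => ⟨fun h => h.1, fun h => ⟨h, F.map (homOfLE h) x, ?_⟩⟩)
    exact (NatTrans.naturality_apply m (homOfLE h) x).symm
  · intro x y h
    exact (mono_iff_injective (m.app p)).1 inferInstance h.1
  · intro x y h
    have h1 : p ∈ ((upχ m).app p x).1 := by
      rw [h]
      exact le_refl p
    obtain ⟨h2, a, ha⟩ := h1
    refine ⟨a, ?_, rfl⟩
    rw [← ha]
    exact ConcreteCategory.congr_hom (G.map_id p) x

theorem upχ_unique {F G : P ⥤ Type u} (m : F ⟶ G) [Mono m] (χ : G ⟶ upΩ P)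
    (h : IsPullback m ((Functor.isTerminalConst P Types.isTerminalPUnit).from F) χ
      (upTruth P)) : χ = upχ m := by
  have hp := fun q : P => (Types.isPullback_iff _ _ _ _).1 ((IsPullback.iff_app.1 h) q)
  ext p x : 5
  refine Subtype.ext (Set.ext fun q => ?_)
  have key : ∀ h' : p ≤ q, (χ.app q (G.map (homOfLE h') x)).1 = (χ.app p x).1 ∩ Set.Ici q :=
    fun h' => congrArg Subtype.val (NatTrans.naturality_apply χ (homOfLE h') x)
  constructor
  · intro hq
    have h' : p ≤ q := (χ.app p x).2.1 hq
    have e : χ.app q (G.map (homOfLE h') x) = (upTruth P).app q PUnit.unit := by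
      refine Subtype.ext ((key h').trans ?_)
      exact Set.inter_eq_right.2 fun r hr => (χ.app p x).2.2 hr hq
    obtain ⟨a, ha, -⟩ := (hp q).2.2 _ _ e
    exact ⟨h', a, ha.symm⟩
  · rintro ⟨h', a, ha⟩
    have e := ConcreteCategory.congr_hom (hp q).1 a
    have e' : (χ.app q (m.app q a)).1 = Set.Ici q := congrArg Subtype.val e
    rw [← ha, key h'] at e'
    have : q ∈ Set.Ici q := le_refl q
    rw [← e'] at this
    exact this.1

variable (P) in
/-- The subobject classifier of the topos `[P, Set]` of presheaves. -/
def presheafClassifier : Subobject.Classifier (P ⥤ Type u) :=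
  .mkOfTerminalΩ₀ ((Functor.const P).obj PUnit) (Functor.isTerminalConst P Types.isTerminalPUnit)
    (upΩ P) (upTruth P) (fun m _ => upχ m) (fun m _ => isPullback_upχ m)
    (fun m _ χ h => upχ_unique m χ h)

namespace KripkeModel

variable (K : KripkeModel.{v, u} L P)

/-- The functor `P ⥤ Set` of the universes of sort `s`. -/
def functor (s : L.Srt) : P ⥤ Type u where
  obj p := (K.model p).dom s
  map f := ↾fun a => K.map (leOfHom f) s a
  map_id p := by
    ext a
    exact K.map_refl p s a
  map_comp f g := by
    ext a
    exact K.map_trans (leOfHom f) (leOfHom g) s a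

/-- The coordinates of an element of a product of such functors. -/
def coord {n : ℕ} (d : Fin n → L.Srt) {p : P} (a : (∏ᶜ fun i => K.functor (d i)).obj p)
    (i : Fin n) : (K.model p).dom (d i) :=
  (Pi.π (fun i => K.functor (d i)) i).app p a

theorem coord_map {n : ℕ} (d : Fin n → L.Srt) {p q : P} (h : p ⟶ q)
    (a : (∏ᶜ fun i => K.functor (d i)).obj p) (i : Fin n) :
    K.coord d ((∏ᶜ fun i => K.functor (d i)).map h a) i =
      K.map (leOfHom h) (d i) (K.coord d a i) :=
  NatTrans.naturality_apply (Pi.π (fun i => K.functor (d i)) i) h a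

/-- The model in the topos `[P, Set]` associated with the Kripke model. -/
def toToposModel : ToposModel (presheafClassifier P) L where
  srt := K.functor
  fn f :=
    { app p := ↾fun a => (K.model p).fn f (K.coord (L.fnDom f) a)
      naturality p q h := by
        ext a
        refine Eq.trans ?_ (K.map_fn (leOfHom h) f _).symm
        exact congrArg _ (funext fun i => K.coord_map _ h a i) }
  rel r :=
    { app p := ↾fun a => (⟨{q | ∃ h : p ≤ q, (K.model q).rel r fun i =>
          K.map h _ (K.coord (L.relDom r) a i)}, fun _ hq => hq.1, by
        rintro q q' hq ⟨h, hr⟩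
        refine ⟨h.trans hq, ?_⟩
        have := K.map_rel hq r _ hr
        simpa only [← K.map_trans] using this⟩ : (upΩ P).obj p)
      naturality p q h := by
        ext a : 3
        refine Subtype.ext (Set.ext fun q' => ?_)
        have e : ∀ h' : q ≤ q', (fun i => K.map h' _ (K.coord (L.relDom r)
            ((∏ᶜ fun i => K.functor (L.relDom r i)).map h a) i)) =
            fun i => K.map ((leOfHom h).trans h') _ (K.coord (L.relDom r) a i) := by
          intro h'
          funext i
          rw [K.coord_map, ← K.map_trans]
        constructor
        · rintro ⟨h', hr⟩
          exact ⟨⟨(leOfHom h).trans h', e h' ▸ hr⟩, h'⟩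
        · rintro ⟨⟨_, hr⟩, h'⟩
          exact ⟨h', (e h').symm ▸ hr⟩ }

end KripkeModel

end Presheaf

end LogDist

end

/-! Arrows of the category are semantic entailments: a morphism from the object of `φ` to that of
`ψ` exists when every stage and every assignment forcing `φ` force `ψ` (`valid_imp`). There is at
most one arrow between two objects, so all diagrams commute, uniqueness clauses are free, and each
condition of logical distributivity reduces to the existence of certain entailments.

The propositional conditions repeat the forcing clauses; exponentials also need persistence
(`Forces.mono`). The quantifiers carry the real idea. Cones are indexed by terms only, while forcing
quantifies over all elements of the universes, which need not be values of closed terms. But the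
variable `x` is itself a term: the component at `x` of a cone with vertex `B` says that `B` entails
`A`. If `x` is not free in `B`, the value of `x` may be changed at will, so `B` entails `∀ x. A`.
The same argument, reversed, treats `∃`; Frobenius is the usual exchange of `∃ x` with a conjunct in
which `x` is not free.

The link with the topos is Kripke–Joyal semantics on presheaves. An arrow into `Ω` is determined by
the elements at which it is true (`hom_eq_iff`), each logical operation on `Ω` obeys the matching
forcing clause, and induction on formulae gives `Represents.isTrue_interp`. Hence validation by the
topos model is validity in the Kripke model (`validates_iff`), and formulae with equal
interpretations are forced alike, so that choosing one formula per interpretation is harmless. -/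

noncomputable section

namespace LogDist

variable {L : Signature.{v}}

/-! ### Values of terms under substitution and abstraction -/

namespace SetModel

variable {A : SetModel.{v, u} L}

theorem eval_congr {w w' : A.Assignment} {Δ : List L.Srt} (e : A.Env Δ) {s : L.Srt}
    (t : Term L Δ s) (h : ∀ x ∈ t.fv, w x = w' x) : eval w e t = eval w' e t := by
  induction t with
  | free x => exact h x (by simp [Term.fv])
  | bound i => rfl
  | app f ts ih =>
    simp only [eval]
    congr 1
    funext i
    exact ih i fun x hx => h x (by simpa [Term.fv] using ⟨i, hx⟩)

theorem eval_lift (w : A.Assignment) {Δ : List L.Srt} (e : A.Env Δ) {s : L.Srt}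
    (t : LTerm L s) : eval w e (t.lift : Term L Δ s) = eval w Env.nil t := by
  match s, t with
  | _, .free x => rfl
  | _, .app f ts =>
    simp only [Term.lift, eval]
    congr 1
    funext i
    exact eval_lift w e (ts i)

theorem eval_subst (w : A.Assignment) {Δ : List L.Srt} (e : A.Env Δ) (σ : Subst L) {s : L.Srt}
    (t : Term L Δ s) : eval w e (t.subst σ) = eval (fun y => eval w Env.nil (σ y)) e t := by
  induction t with
  | free x => exact eval_lift w e (σ x)
  | bound i => rfl
  | app f ts ih =>
    simp only [Term.subst, eval]
    congr 1
    funext i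
    exact ih i

theorem eval_abs (x : L.Var) {w w' : A.Assignment} {Δ : List L.Srt} {e : A.Env Δ}
    {e' : A.Env (Δ ++ [x.1])} (hx : w' x = e' _ (Ix.last Δ)) (hw : ∀ y, y ≠ x → w' y = w y)
    (he : ∀ s (i : Ix Δ s), e' s i.weaken = e s i) {s : L.Srt} (t : Term L Δ s) :
    eval w e' (t.abs x) = eval w' e t := by
  induction t with
  | free y =>
    by_cases h : x = y
    · subst h
      simp [Term.abs, eval, hx]
    · simp [Term.abs, eval, h, hw y (Ne.symm h)]
  | bound i => exact he _ i
  | app f ts ih =>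
    simp only [Term.abs, eval]
    congr 1
    funext i
    exact ih i

end SetModel

/-! ### Forcing: persistence, substitution, named quantifiers -/

namespace KripkeModel

variable {P : Type u} [PartialOrder P] (K : KripkeModel.{v, u} L P)

theorem map_eval {p q : P} (h : p ≤ q) (w : (K.model p).Assignment) {Δ : List L.Srt}
    (e : (K.model p).Env Δ) {s : L.Srt} (t : Term L Δ s) :
    K.map h s (SetModel.eval w e t) =
      SetModel.eval (fun x => K.map h _ (w x)) (fun _ i => K.map h _ (e _ i)) t := by
  induction t with
  | free x => rfl
  | bound i => rfl
  | app f ts ih =>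
    simp only [SetModel.eval]
    rw [K.map_fn]
    congr 1
    funext i
    exact ih i

theorem map_cons {p q : P} (h : p ≤ q) {Δ : List L.Srt} {s : L.Srt} (a : (K.model p).dom s)
    (e : (K.model p).Env Δ) :
    (fun s' i => K.map h s' (SetModel.Env.cons a e s' i)) =
      SetModel.Env.cons (K.map h s a) (fun s' i => K.map h s' (e s' i)) := by
  funext s' i
  cases i <;> rfl

theorem map_nil {p q : P} (h : p ≤ q) :
    (fun s' i => K.map h s' ((SetModel.Env.nil : (K.model p).Env []) s' i)) =
      SetModel.Env.nil := by
  funext s' i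
  cases i

/-- Persistence. Atoms use that the transition maps preserve relations and commute with evaluation.
The clauses for `⊃` and `∀` already range over all later stages, so functoriality suffices there,
without an induction hypothesis. -/
theorem Forces.mono {p q : P} (h : p ≤ q) {Δ : List L.Srt} {φ : Formula L Δ}
    {w : (K.model p).Assignment} {e : (K.model p).Env Δ} (hφ : K.Forces p w e φ) :
    K.Forces q (fun x => K.map h _ (w x)) (fun _ i => K.map h _ (e _ i)) φ := by
  induction φ with
  | top => trivial
  | bot => exact hφ
  | rel r ts =>
    have := K.map_rel h r _ hφ
    simp only [map_eval] at this
    exact this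
  | and A B ihA ihB => exact ⟨ihA hφ.1, ihB hφ.2⟩
  | or A B ihA ihB => exact hφ.imp ihA ihB
  | imp A B =>
    intro r hr
    simp only [← K.map_trans]
    exact hφ r (h.trans hr)
  | all s A =>
    intro r hr a
    simp only [← K.map_trans]
    exact hφ r (h.trans hr) a
  | ex s A ih =>
    obtain ⟨a, ha⟩ := hφ
    refine ⟨K.map h s a, ?_⟩
    rw [← K.map_cons]
    exact ih ha

theorem forces_congr {p : P} {Δ : List L.Srt} (φ : Formula L Δ)
    {w w' : (K.model p).Assignment} (e : (K.model p).Env Δ) (h : ∀ x ∈ φ.fv, w x = w' x) :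
    K.Forces p w e φ ↔ K.Forces p w' e φ := by
  induction φ generalizing p with
  | top | bot => rfl
  | rel r ts =>
    simp only [Forces]
    refine iff_of_eq (congrArg _ (funext fun i => SetModel.eval_congr e _ fun x hx => h x ?_))
    simpa [Formula.fv] using ⟨i, hx⟩
  | and A B ihA ihB =>
    exact and_congr (ihA e fun x hx => h x (by simp [Formula.fv, hx]))
      (ihB e fun x hx => h x (by simp [Formula.fv, hx]))
  | or A B ihA ihB =>
    exact or_congr (ihA e fun x hx => h x (by simp [Formula.fv, hx]))
      (ihB e fun x hx => h x (by simp [Formula.fv, hx]))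
  | imp A B ihA ihB =>
    refine forall_congr' fun q => forall_congr' fun hq => ?_
    exact imp_congr (ihA _ fun x hx => congrArg _ (h x (by simp [Formula.fv, hx])))
      (ihB _ fun x hx => congrArg _ (h x (by simp [Formula.fv, hx])))
  | all s A ih =>
    refine forall_congr' fun q => forall_congr' fun hq => forall_congr' fun a => ?_
    exact ih _ fun x hx => congrArg _ (h x hx)
  | ex s A ih => exact exists_congr fun a => ih _ h

theorem forces_subst {p : P} {Δ : List L.Srt} (σ : Subst L) (φ : Formula L Δ)
    (w : (K.model p).Assignment) (e : (K.model p).Env Δ) :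
    K.Forces p w e (φ.subst σ) ↔
      K.Forces p (fun y => SetModel.eval w SetModel.Env.nil (σ y)) e φ := by
  induction φ generalizing p with
  | top | bot => rfl
  | rel r ts => simp only [Formula.subst, Forces, SetModel.eval_subst]
  | and A B ihA ihB => exact and_congr (ihA w e) (ihB w e)
  | or A B ihA ihB => exact or_congr (ihA w e) (ihB w e)
  | imp A B ihA ihB =>
    refine forall_congr' fun q => forall_congr' fun hq => ?_
    simp only [map_eval, map_nil]
    exact imp_congr (ihA _ _) (ihB _ _)
  | all s A ih =>
    refine forall_congr' fun q => forall_congr' fun hq => forall_congr' fun a => ?_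
    simp only [map_eval, map_nil]
    exact ih _ _
  | ex s A ih => exact exists_congr fun a => ih w _

/-- Abstraction only moves the value of `x` from the assignment to the outermost position. Inner
quantifiers add positions at the front, so arbitrary environments are needed for the induction, and
the hypotheses on `e'` survive each such extension. -/
theorem forces_abs {p : P} (x : L.Var) {Δ : List L.Srt} (φ : Formula L Δ)
    {w w' : (K.model p).Assignment} {e : (K.model p).Env Δ} {e' : (K.model p).Env (Δ ++ [x.1])}
    (hx : w' x = e' _ (Ix.last Δ)) (hw : ∀ y, y ≠ x → w' y = w y)
    (he : ∀ s (i : Ix Δ s), e' s i.weaken = e s i) :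
    K.Forces p w e' (φ.abs x) ↔ K.Forces p w' e φ := by
  induction φ generalizing p with
  | top | bot => rfl
  | rel r ts => simp only [Formula.abs, Forces, SetModel.eval_abs x hx hw he]
  | and A B ihA ihB => exact and_congr (ihA hx hw he) (ihB hx hw he)
  | or A B ihA ihB => exact or_congr (ihA hx hw he) (ihB hx hw he)
  | imp A B ihA ihB =>
    refine forall_congr' fun q => forall_congr' fun hq => ?_
    exact imp_congr
      (ihA (congrArg _ hx) (fun y hy => congrArg _ (hw y hy)) fun s i => congrArg _ (he s i))
      (ihB (congrArg _ hx) (fun y hy => congrArg _ (hw y hy)) fun s i => congrArg _ (he s i))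
  | all s A ih =>
    refine forall_congr' fun q => forall_congr' fun hq => forall_congr' fun a => ?_
    refine ih (congrArg _ hx) (fun y hy => congrArg _ (hw y hy)) fun s i => ?_
    cases i with
    | here => rfl
    | there i => exact congrArg _ (he _ i)
  | ex s A ih =>
    refine exists_congr fun a => ih hx hw fun s i => ?_
    cases i with
    | here => rfl
    | there i => exact he _ i

/-- `φ` holds at `p` for the values `w` of its free variables. -/
abbrev Holds (p : P) (w : (K.model p).Assignment) (φ : LForm L) : Prop :=
  K.Forces p w SetModel.Env.nil φ

variable {K}

theorem Holds.mono {p q : P} (h : p ≤ q) {φ : LForm L} {w : (K.model p).Assignment}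
    (hφ : K.Holds p w φ) : K.Holds q (fun x => K.map h _ (w x)) φ := by
  have := Forces.mono K h hφ
  rwa [map_nil] at this

variable (K)

theorem holds_imp {p : P} {w : (K.model p).Assignment} {A B : LForm L} :
    K.Holds p w (.imp A B) ↔ ∀ (q : P) (h : p ≤ q),
      K.Holds q (fun x => K.map h _ (w x)) A → K.Holds q (fun x => K.map h _ (w x)) B := by
  simp only [Holds, Forces, map_nil]

/-- Validity already quantifies over all stages and assignments, which absorbs the later stages in
the clause for `⊃`. Entailments in this local form compose even when the middle formula has
additional free variables, since assignments are total. -/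
theorem valid_imp {A B : LForm L} :
    K.Valid (.imp A B) ↔ ∀ (p : P) (w : (K.model p).Assignment), K.Holds p w A → K.Holds p w B := by
  constructor
  · intro h p w hA
    have := (K.holds_imp).1 (h p w) p le_rfl
    simp only [K.map_refl] at this
    exact this hA
  · intro h p w
    exact (K.holds_imp).2 fun q hq => h q _

open scoped Classical in
theorem holds_inst {p : P} {w : (K.model p).Assignment} {A : LForm L} {x : L.Var}
    {t : LTerm L x.1} :
    K.Holds p w (A.inst x t) ↔
      K.Holds p (Function.update w x (SetModel.eval w SetModel.Env.nil t)) A := by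
  unfold Holds Formula.inst
  rw [forces_subst]
  refine iff_of_eq (congrArg (fun w => K.Forces p w _ A) (funext fun y => ?_))
  by_cases h : y = x
  · subst h; simp
  · simp [h, SetModel.eval]

open scoped Classical in
theorem holds_exV {p : P} {w : (K.model p).Assignment} {A : LForm L} {x : L.Var} :
    K.Holds p w (A.exV x) ↔ ∃ a, K.Holds p (Function.update w x a) A := by
  refine exists_congr fun a => K.forces_abs (e := SetModel.Env.nil) x A ?_ ?_ ?_
  · simp; rfl
  · intro y hy; simp [hy]
  · intro s i; cases i

open scoped Classical in
theorem holds_allV {p : P} {w : (K.model p).Assignment} {A : LForm L} {x : L.Var} :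
    K.Holds p w (A.allV x) ↔ ∀ (q : P) (h : p ≤ q) (a : (K.model q).dom x.1),
      K.Holds q (Function.update (fun y => K.map h _ (w y)) x a) A := by
  refine forall_congr' fun q => forall_congr' fun hq => forall_congr' fun a =>
    K.forces_abs (e := SetModel.Env.nil) x A ?_ ?_ ?_
  · simp; rfl
  · intro y hy; simp [hy]
  · intro s i; cases i

open scoped Classical in
theorem holds_update_of_notMem {p : P} {w : (K.model p).Assignment} {A : LForm L} {x : L.Var}
    (hx : x ∉ A.fv) (a : (K.model p).dom x.1) :
    K.Holds p (Function.update w x a) A ↔ K.Holds p w A :=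
  K.forces_congr A _ fun y hy => Function.update_of_ne (show y ≠ x from fun e => hx (e ▸ hy)) _ _

end KripkeModel

/-! ### Kripke–Joyal semantics for arrows into `Ω` -/

section PresheafSemantics

variable {P : Type u} [PartialOrder P] {F G : P ⥤ Type u} {p : P}

/-- The natural transformation from the representable functor that is given by an element. -/
def pointHom (x : G.obj p) : coyoneda.obj (Opposite.op p) ⟶ G := coyonedaEquiv.symm x

/-- The universal element of the representable functor. -/
def pointId (p : P) : (coyoneda.obj (Opposite.op p)).obj p := 𝟙 p

theorem pointHom_id (x : G.obj p) : (pointHom x).app p (pointId p) = x := by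
  exact ConcreteCategory.congr_hom (G.map_id p) x

theorem pointHom_comp (x : G.obj p) (f : G ⟶ F) : pointHom x ≫ f = pointHom (f.app p x) := by
  ext q h
  exact NatTrans.naturality_apply f h x

theorem pointHom_injective {x y : G.obj p} (h : pointHom x = pointHom y) : x = y := by
  rw [← pointHom_id x, h, pointHom_id]

/-- `x` belongs to the subfunctor with the character `f`. -/
def IsTrue (f : G ⟶ (presheafClassifier P).Ω) (x : G.obj p) : Prop :=
  p ∈ (show {S : Set P // S ⊆ Set.Ici p ∧ IsUpperSet S} from f.app p x).1

/-- By naturality, the value of `f` at the restriction of `x` to `q` is the part above `q` of its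
value at `x`. The whole upper set is thus recovered from truth at the restrictions. -/
theorem mem_app_iff (f : G ⟶ (presheafClassifier P).Ω) (x : G.obj p) (q : P) :
    q ∈ (show {S : Set P // S ⊆ Set.Ici p ∧ IsUpperSet S} from f.app p x).1 ↔
      ∃ h : p ≤ q, IsTrue f (G.map (homOfLE h) x) := by
  have key : ∀ h : p ≤ q,
      (show {S : Set P // S ⊆ Set.Ici q ∧ IsUpperSet S} from f.app q (G.map (homOfLE h) x)).1 =
        (show {S : Set P // S ⊆ Set.Ici p ∧ IsUpperSet S} from f.app p x).1 ∩ Set.Ici q :=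
    fun h => congrArg Subtype.val (NatTrans.naturality_apply f (homOfLE h) x)
  constructor
  · intro hq
    have h : p ≤ q := (show {S : Set P // S ⊆ Set.Ici p ∧ IsUpperSet S} from f.app p x).2.1 hq
    refine ⟨h, ?_⟩
    unfold IsTrue
    rw [key h]
    exact ⟨hq, le_refl q⟩
  · rintro ⟨h, hq⟩
    unfold IsTrue at hq
    rw [key h] at hq
    exact hq.1

theorem app_eq_app_iff (f g : G ⟶ (presheafClassifier P).Ω) (x : G.obj p) :
    f.app p x = g.app p x ↔ ∀ (q : P) (h : p ≤ q),
      IsTrue f (G.map (homOfLE h) x) ↔ IsTrue g (G.map (homOfLE h) x) := by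
  constructor
  · intro e q h
    have := mem_app_iff f x q
    rw [e, mem_app_iff g x q] at this
    exact ⟨fun h' => (this.2 ⟨h, h'⟩).2, fun h' => (this.1 ⟨h, h'⟩).2⟩
  · intro h
    refine Subtype.ext (Set.ext fun q => ?_)
    refine (mem_app_iff f x q).trans (Iff.trans ?_ (mem_app_iff g x q).symm)
    exact exists_congr fun hq => h q hq

theorem hom_eq_iff (f g : G ⟶ (presheafClassifier P).Ω) :
    f = g ↔ ∀ (p : P) (x : G.obj p), IsTrue f x ↔ IsTrue g x := by
  constructor
  · rintro rfl p x
    rfl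
  · intro h
    ext p x
    exact (app_eq_app_iff f g x).2 fun q _ => h q _

theorem isTrue_χ (m : F ⟶ G) [Mono m] (x : G.obj p) :
    IsTrue ((presheafClassifier P).χ m) x ↔ ∃ a, m.app p a = x := by
  constructor
  · rintro ⟨_, a, ha⟩
    refine ⟨a, ha.symm.trans ?_⟩
    exact ConcreteCategory.congr_hom (G.map_id p) x
  · rintro ⟨a, ha⟩
    refine ⟨le_refl p, a, Eq.trans ?_ ha.symm⟩
    exact ConcreteCategory.congr_hom (G.map_id p) x

theorem isTrue_trueAt (x : G.obj p) : IsTrue (trueAt (presheafClassifier P) G) x :=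
  le_refl p

theorem app_eq_truth_iff (f : G ⟶ (presheafClassifier P).Ω) (x : G.obj p)
    (a : (presheafClassifier P).Ω₀.obj p) :
    f.app p x = (presheafClassifier P).truth.app p a ↔ IsTrue f x := by
  constructor
  · intro h
    unfold IsTrue
    rw [h]
    exact le_refl p
  · intro h
    refine Subtype.ext (Set.Subset.antisymm ?_ ?_)
    · exact (show {S : Set P // S ⊆ Set.Ici p ∧ IsUpperSet S} from f.app p x).2.1
    · exact fun q hq =>
        (show {S : Set P // S ⊆ Set.Ici p ∧ IsUpperSet S} from f.app p x).2.2 hq h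

theorem not_isTrue_falseAt (x : G.obj p) : ¬ IsTrue (falseAt (presheafClassifier P) G) x := by
  intro h
  have : Mono (initial.to (𝟙_ (P ⥤ Type u))) := initial_mono (𝟙_ _) initialIsInitial
  obtain ⟨a, -⟩ := (isTrue_χ (initial.to (𝟙_ (P ⥤ Type u))) _).1 h
  -- The initial presheaf has no elements, as it maps to the constant empty presheaf.
  exact ((initial.to ((Functor.const P).obj PEmpty.{u + 1})).app p a).elim

/-- The map onto the image is epi, and epimorphisms of presheaves are surjective at each stage. -/
theorem exists_image_ι_iff (f : F ⟶ G) (x : G.obj p) :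
    (∃ a, (image.ι f).app p a = x) ↔ ∃ a, f.app p a = x := by
  constructor
  · rintro ⟨a, rfl⟩
    have : Epi ((factorThruImage f).app p) :=
      (NatTrans.epi_iff_epi_app _).1 inferInstance p
    obtain ⟨b, rfl⟩ := (epi_iff_surjective _).1 this a
    exact ⟨b, (NatTrans.congr_app (image.fac f) p ▸ rfl :
      f.app p b = ((factorThruImage f ≫ image.ι f).app p b))⟩
  · rintro ⟨a, rfl⟩
    refine ⟨(factorThruImage f).app p a, ?_⟩
    exact ConcreteCategory.congr_hom (NatTrans.congr_app (image.fac f) p) a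

theorem coprod_jointly_surjective (z : (F ⨿ G).obj p) :
    (∃ a, (coprod.inl : F ⟶ F ⨿ G).app p a = z) ∨
      ∃ b, (coprod.inr : G ⟶ F ⨿ G).app p b = z := by
  obtain ⟨⟨j⟩, y, hy⟩ := FunctorToTypes.jointly_surjective' (F := pair F G) p z
  cases j with
  | left => exact Or.inl ⟨y, hy.symm⟩
  | right => exact Or.inr ⟨y, hy.symm⟩

/-- Yoneda: an element is an arrow from a representable, so the universal property applies to it;
evaluating the lift at the identity gives back an element. Pullbacks and finite products below are
handled in the same way. -/
theorem exists_equalizer_ι_iff (f g : F ⟶ G) (x : F.obj p) :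
    (∃ a, (equalizer.ι f g).app p a = x) ↔ f.app p x = g.app p x := by
  constructor
  · rintro ⟨a, rfl⟩
    exact ConcreteCategory.congr_hom (NatTrans.congr_app (equalizer.condition f g) p) a
  · intro h
    have e : pointHom x ≫ f = pointHom x ≫ g := by rw [pointHom_comp, pointHom_comp, h]
    refine ⟨(equalizer.lift (pointHom x) e).app p (pointId p), ?_⟩
    refine Eq.trans ?_ (pointHom_id x)
    exact ConcreteCategory.congr_hom (NatTrans.congr_app (equalizer.lift_ι (pointHom x) e) p) _

theorem exists_pullback_fst_iff {H : P ⥤ Type u} (f : F ⟶ H) (g : G ⟶ H) (x : F.obj p) :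
    (∃ a, (pullback.fst f g).app p a = x) ↔ ∃ y, f.app p x = g.app p y := by
  constructor
  · rintro ⟨a, rfl⟩
    exact ⟨(pullback.snd f g).app p a,
      ConcreteCategory.congr_hom (NatTrans.congr_app (pullback.condition (f := f) (g := g)) p) a⟩
  · rintro ⟨y, h⟩
    have e : pointHom x ≫ f = pointHom y ≫ g := by rw [pointHom_comp, pointHom_comp, h]
    refine ⟨(pullback.lift (pointHom x) (pointHom y) e).app p (pointId p), ?_⟩
    refine Eq.trans ?_ (pointHom_id x)
    exact ConcreteCategory.congr_hom
      (NatTrans.congr_app (pullback.lift_fst (pointHom x) (pointHom y) e) p) _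

theorem isTrue_andΩ (f g : G ⟶ (presheafClassifier P).Ω) (x : G.obj p) :
    IsTrue (lift f g ≫ andΩ (presheafClassifier P)) x ↔ IsTrue f x ∧ IsTrue g x := by
  have : Mono (lift (presheafClassifier P).truth (presheafClassifier P).truth) :=
    (presheafClassifier P).isTerminalΩ₀.mono_from _
  refine (isTrue_χ (lift (presheafClassifier P).truth (presheafClassifier P).truth) _).trans ?_
  constructor
  · rintro ⟨a, ha⟩
    exact ⟨(app_eq_truth_iff f x a).1 (congrArg Prod.fst ha).symm,
      (app_eq_truth_iff g x a).1 (congrArg Prod.snd ha).symm⟩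
  · rintro ⟨hf, hg⟩
    exact ⟨PUnit.unit, Prod.ext ((app_eq_truth_iff f x _).2 hf).symm
      ((app_eq_truth_iff g x _).2 hg).symm⟩

theorem isTrue_orΩ (f g : G ⟶ (presheafClassifier P).Ω) (x : G.obj p) :
    IsTrue (lift f g ≫ orΩ (presheafClassifier P)) x ↔ IsTrue f x ∨ IsTrue g x := by
  let O := (presheafClassifier P).Ω
  let T := (presheafClassifier P).truth.app p PUnit.unit
  let l := lift (trueAt (presheafClassifier P) O) (𝟙 O)
  let r := lift (𝟙 O) (trueAt (presheafClassifier P) O)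
  have hl : ∀ a, (coprod.desc l r).app p ((coprod.inl : O ⟶ O ⨿ O).app p a) = (T, a) := fun a =>
    ConcreteCategory.congr_hom (NatTrans.congr_app (coprod.inl_desc l r) p) a
  have hr : ∀ a, (coprod.desc l r).app p ((coprod.inr : O ⟶ O ⨿ O).app p a) = (a, T) := fun a =>
    ConcreteCategory.congr_hom (NatTrans.congr_app (coprod.inr_desc l r) p) a
  refine (isTrue_χ (image.ι (coprod.desc l r)) _).trans ((exists_image_ι_iff _ _).trans ?_)
  constructor
  · rintro ⟨z, hz⟩
    obtain ⟨a, rfl⟩ | ⟨a, rfl⟩ := coprod_jointly_surjective z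
    · rw [hl] at hz
      exact Or.inl ((app_eq_truth_iff f x PUnit.unit).1 (congrArg Prod.fst hz).symm)
    · rw [hr] at hz
      exact Or.inr ((app_eq_truth_iff g x PUnit.unit).1 (congrArg Prod.snd hz).symm)
  · rintro (h | h)
    · exact ⟨_, (hl (g.app p x)).trans (Prod.ext ((app_eq_truth_iff f x _).2 h).symm rfl)⟩
    · exact ⟨_, (hr (f.app p x)).trans (Prod.ext rfl ((app_eq_truth_iff g x _).2 h).symm)⟩

theorem isTrue_impΩ (f g : G ⟶ (presheafClassifier P).Ω) (x : G.obj p) :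
    IsTrue (lift f g ≫ impΩ (presheafClassifier P)) x ↔ ∀ (q : P) (h : p ≤ q),
      IsTrue f (G.map (homOfLE h) x) → IsTrue g (G.map (homOfLE h) x) := by
  refine (isTrue_χ (equalizer.ι (andΩ (presheafClassifier P)) (fst _ _)) _).trans
    ((exists_equalizer_ι_iff _ _ _).trans ?_)
  -- Lying in the equaliser means that `f ∧ g` and `f` agree at `x`, hence have the same truth at
  -- all later stages.
  refine (app_eq_app_iff (lift f g ≫ andΩ (presheafClassifier P)) f x).trans ?_
  simp only [isTrue_andΩ]
  refine forall_congr' fun q => forall_congr' fun h => ?_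
  tauto

/-- The element of a product of functors with the given components. -/
def tensorPair (a : F.obj p) (x : G.obj p) : (F ⊗ G).obj p := (a, x)

theorem isTrue_allΩ (A : P ⥤ Type u) (f : A ⊗ G ⟶ (presheafClassifier P).Ω) (x : G.obj p) :
    IsTrue (MonoidalClosed.curry f ≫ allΩ (presheafClassifier P) A) x ↔
      ∀ (q : P) (h : p ≤ q) (a : A.obj q),
        IsTrue f (tensorPair a (G.map (homOfLE h) x)) := by
  have : Mono (MonoidalClosed.curry
      (fst A (presheafClassifier P).Ω₀ ≫ trueAt (presheafClassifier P) A)) :=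
    (presheafClassifier P).isTerminalΩ₀.mono_from _
  refine (isTrue_χ (MonoidalClosed.curry
    (fst A (presheafClassifier P).Ω₀ ≫ trueAt (presheafClassifier P) A)) _).trans ?_
  -- By Yoneda and currying, elements of the power object at `p` are arrows into `Ω` from the
  -- product of `A` with the representable at `p`. Their equality can then be tested by `hom_eq_iff`
  -- on pairs of an element of `A` at `q` and a proof of `p ≤ q`.
  have key : ∀ z : (presheafClassifier P).Ω₀.obj p,
      (MonoidalClosed.curry (fst A (presheafClassifier P).Ω₀ ≫ trueAt (presheafClassifier P) A)).app p z =
          (MonoidalClosed.curry f).app p x ↔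
        A ◁ pointHom z ≫ fst A (presheafClassifier P).Ω₀ ≫ trueAt (presheafClassifier P) A =
          A ◁ pointHom x ≫ f := by
    intro z
    rw [← MonoidalClosed.curry_injective.eq_iff, MonoidalClosed.curry_natural_left,
      MonoidalClosed.curry_natural_left, pointHom_comp, pointHom_comp]
    exact ⟨congrArg _, pointHom_injective⟩
  constructor
  · rintro ⟨z, hz⟩ q h a
    exact ((hom_eq_iff _ _).1 ((key z).1 hz) q (a, homOfLE h)).1 (isTrue_trueAt (G := A) a)
  · intro h
    refine ⟨PUnit.unit, (key _).2 ((hom_eq_iff _ _).2 fun q y =>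
      ⟨fun _ => ?_, fun _ => isTrue_trueAt (G := A) y.1⟩)⟩
    exact h q (leOfHom y.2) y.1

theorem isTrue_exΩ (A : P ⥤ Type u) (f : A ⊗ G ⟶ (presheafClassifier P).Ω) (x : G.obj p) :
    IsTrue (MonoidalClosed.curry f ≫ exΩ (presheafClassifier P) A) x ↔
      ∃ a : A.obj p, IsTrue f (tensorPair a x) := by
  refine (isTrue_χ (image.ι
    (memΩ (presheafClassifier P) A ≫ snd A ((ihom A).obj (presheafClassifier P).Ω))) _).trans
    ((exists_image_ι_iff _ _).trans ?_)
  -- Evaluating the transpose of `f` returns `f`, so membership of `a` in the subset named by `x` is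
  -- truth of `f` at `(a, x)`.
  have key : ∀ a : A.obj p, ((ihom.ev A).app (presheafClassifier P).Ω).app p
      (tensorPair a ((MonoidalClosed.curry f).app p x)) =
        f.app p (tensorPair a x) := fun a =>
    ConcreteCategory.congr_hom (NatTrans.congr_app
      (MonoidalClosed.whiskerLeft_curry_ihom_ev_app A (presheafClassifier P).Ω f) p)
        (tensorPair (F := A) (G := G) (p := p) a x)
  constructor
  · rintro ⟨z, hz⟩
    obtain ⟨y, hy⟩ :=
      (exists_pullback_fst_iff ((ihom.ev A).app (presheafClassifier P).Ω)
        (presheafClassifier P).truth _).1 ⟨z, rfl⟩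
    refine ⟨((memΩ (presheafClassifier P) A).app p z).1, (app_eq_truth_iff f _ y).1 ?_⟩
    rw [← key, ← hy]
    exact congrArg _ (Prod.ext rfl hz.symm)
  · rintro ⟨a, ha⟩
    obtain ⟨z, hz⟩ :=
      (exists_pullback_fst_iff ((ihom.ev A).app (presheafClassifier P).Ω)
        (presheafClassifier P).truth
      (tensorPair a ((MonoidalClosed.curry f).app p x))).2
      ⟨PUnit.unit, (key a).trans ((app_eq_truth_iff f _ _).2 ha)⟩
    exact ⟨z, congrArg Prod.snd hz⟩

theorem pi_π_app_pi_lift_app {ι : Type w} [Finite ι] (D : ι → (P ⥤ Type u)) (f : ∀ i, G ⟶ D i)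
    (x : G.obj p) (i : ι) : (Pi.π D i).app p ((Pi.lift f).app p x) = (f i).app p x :=
  ConcreteCategory.congr_hom (NatTrans.congr_app (Pi.lift_π f i) p) x

theorem exists_pi_π_eq {ι : Type w} [Finite ι] (D : ι → (P ⥤ Type u)) (a : ∀ i, (D i).obj p) :
    ∃ x : (∏ᶜ D).obj p, ∀ i, (Pi.π D i).app p x = a i :=
  ⟨(Pi.lift fun i => pointHom (a i)).app p (pointId p), fun i =>
    (pi_π_app_pi_lift_app D _ _ i).trans (pointHom_id (a i))⟩

end PresheafSemantics

/-! ### Agreement of the topos interpretation with forcing -/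

namespace KripkeModel

variable {P : Type u} [PartialOrder P] (K : KripkeModel.{v, u} L P)

theorem isTrue_rel (r : L.Rel) {p : P} (a : (∏ᶜ fun i => K.functor (L.relDom r i)).obj p) :
    IsTrue (K.toToposModel.rel r) a ↔ (K.model p).rel r (K.coord (L.relDom r) a) := by
  have h : (fun i => K.map (le_refl p) _ (K.coord (L.relDom r) a i)) = K.coord (L.relDom r) a :=
    funext fun i => K.map_refl p _ _
  constructor
  · rintro ⟨_, hr⟩
    exact h ▸ hr
  · intro hr
    exact ⟨le_refl p, h.symm ▸ hr⟩

/-- The values `w`, `e` of the variables are the coordinates of the element `x` of the context. -/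
structure Represents (Γ : Finset L.Var) (Δ : List L.Srt) {p : P}
    (x : (K.toToposModel.ctx Γ Δ).obj p) (w : (K.model p).Assignment) (e : (K.model p).Env Δ) :
    Prop where
  free : ∀ y : Γ, (K.toToposModel.projFree Γ y Δ).app p x = w y.1
  bound : ∀ (s : L.Srt) (i : Ix Δ s), (K.toToposModel.projBound Γ i).app p x = e s i

variable {K} {Γ : Finset L.Var} {Δ : List L.Srt} {p : P}
  {x : (K.toToposModel.ctx Γ Δ).obj p} {w : (K.model p).Assignment} {e : (K.model p).Env Δ}

theorem Represents.map (hx : K.Represents Γ Δ x w e) {q : P} (h : p ≤ q) :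
    K.Represents Γ Δ ((K.toToposModel.ctx Γ Δ).map (homOfLE h) x) (fun y => K.map h _ (w y))
      (fun _ i => K.map h _ (e _ i)) where
  free y := (NatTrans.naturality_apply (K.toToposModel.projFree Γ y Δ) (homOfLE h) x).trans
    (congrArg (K.map h _) (hx.free y))
  bound s i := (NatTrans.naturality_apply (K.toToposModel.projBound Γ i) (homOfLE h) x).trans
    (congrArg (K.map h _) (hx.bound s i))

theorem Represents.cons (hx : K.Represents Γ Δ x w e) {s : L.Srt} (a : (K.model p).dom s) :
    K.Represents Γ (s :: Δ)
      (tensorPair (F := K.functor s) a x) w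
      (SetModel.Env.cons a e) where
  free y := hx.free y
  bound s' i := by
    cases i with
    | here => rfl
    | there i => exact hx.bound s' i

theorem Represents.termInterp_app (hx : K.Represents Γ Δ x w e) {s : L.Srt} (t : Term L Δ s)
    (ht : t.fv ⊆ Γ) :
    (K.toToposModel.termInterp Γ t ht).app p x = SetModel.eval w e t := by
  induction t with
  | free y => exact hx.free _
  | bound i => exact hx.bound _ i
  | app f ts ih =>
    refine congrArg ((K.model p).fn f) (funext fun i => ?_)
    refine Eq.trans ?_ (ih i fun _ hy => ht (by simpa [Term.fv] using ⟨i, hy⟩))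
    exact pi_π_app_pi_lift_app (fun i => K.functor (L.fnDom f i)) _ x i

/-- Each operation on `Ω` has the truth condition of the forcing clause for its connective. The
stage must vary in the induction, because `⊃` and `∀` move to later ones. -/
theorem Represents.isTrue_interp (hx : K.Represents Γ Δ x w e) (φ : Formula L Δ)
    (hφ : φ.fv ⊆ Γ) :
    IsTrue (K.toToposModel.interp Γ φ hφ) x ↔ K.Forces p w e φ := by
  induction φ generalizing p with
  | top => exact iff_true_intro (isTrue_trueAt x)
  | bot => exact iff_false_intro (not_isTrue_falseAt x)
  | rel r ts =>
    have ht : ∀ i, (ts i).fv ⊆ Γ := fun i _ hy => hφ (by simpa [Formula.fv] using ⟨i, hy⟩)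
    refine (K.isTrue_rel r _).trans (iff_of_eq (congrArg ((K.model p).rel r) (funext fun i => ?_)))
    exact (pi_π_app_pi_lift_app (fun i => K.functor (L.relDom r i)) _ x i).trans
      (hx.termInterp_app (ts i) (ht i))
  | and A B ihA ihB => exact (isTrue_andΩ _ _ x).trans (and_congr (ihA hx _) (ihB hx _))
  | or A B ihA ihB => exact (isTrue_orΩ _ _ x).trans (or_congr (ihA hx _) (ihB hx _))
  | imp A B ihA ihB =>
    refine (isTrue_impΩ _ _ x).trans (forall_congr' fun q => forall_congr' fun h => ?_)
    exact imp_congr (ihA (hx.map h) _) (ihB (hx.map h) _)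
  | all s A ih =>
    refine (isTrue_allΩ _ _ x).trans
      (forall_congr' fun q => forall_congr' fun h => forall_congr' fun a => ?_)
    exact ih ((hx.map h).cons a) hφ
  | ex s A ih =>
    exact (isTrue_exΩ _ _ x).trans (exists_congr fun a => ih (hx.cons a) hφ)

variable (K)

theorem exists_represents (Γ : Finset L.Var) (w : (K.model p).Assignment) :
    ∃ x, K.Represents Γ [] x w SetModel.Env.nil := by
  obtain ⟨x, hx⟩ := exists_pi_π_eq (fun y : Γ => K.functor y.1.1) fun y => w y.1
  exact ⟨x, hx, fun s i => nomatch i⟩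

open scoped Classical in
theorem exists_assignment_represents (Γ : Finset L.Var)
    (x : (K.toToposModel.ctx Γ []).obj p) :
    ∃ w, K.Represents Γ [] x w SetModel.Env.nil := by
  let c (y : L.Var) (h : y ∈ Γ) : (K.model p).dom y.1 :=
    (K.toToposModel.projFree Γ ⟨y, h⟩ []).app p x
  -- Variables outside the context get arbitrary values; this is where inhabited universes are
  -- needed.
  exact ⟨fun y => if h : y ∈ Γ then c y h else Classical.choice ((K.model p).nonempty y.1),
    fun y => (dif_pos (c := y.1 ∈ Γ) (t := c y.1) y.2).symm, fun s i => nomatch i⟩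

/-- The right-hand side depends on `φ` only through the pair of context and arrow, so an equality of
interpretations can be rewritten there without transporting arrows between contexts. -/
theorem holds_iff_sem (φ : LForm L) (w : (K.model p).Assignment) :
    K.Holds p w φ ↔
      ∃ x, K.Represents (K.toToposModel.sem φ).1 [] x w SetModel.Env.nil ∧
        IsTrue (K.toToposModel.sem φ).2 x := by
  constructor
  · intro h
    obtain ⟨x, hx⟩ := K.exists_represents φ.fv w
    exact ⟨x, hx, (hx.isTrue_interp φ _).2 h⟩
  · rintro ⟨x, hx, h⟩
    exact (hx.isTrue_interp φ _).1 h

theorem holds_congr_of_sem_eq {φ ψ : LForm L}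
    (h : K.toToposModel.sem φ = K.toToposModel.sem ψ) (w : (K.model p).Assignment) :
    K.Holds p w φ ↔ K.Holds p w ψ := by
  rw [holds_iff_sem, holds_iff_sem, h]

theorem validates_iff (φ : LForm L) : K.toToposModel.Validates φ ↔ K.Valid φ := by
  refine (hom_eq_iff _ _).trans (forall_congr' fun p => ?_)
  constructor
  · intro h w
    obtain ⟨x, hx⟩ := K.exists_represents φ.fv w
    exact (hx.isTrue_interp φ _).1 ((h x).2 (isTrue_trueAt x))
  · intro h x
    obtain ⟨w, hx⟩ := K.exists_assignment_represents φ.fv x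
    exact iff_of_true ((hx.isTrue_interp φ _).2 (h w)) (isTrue_trueAt x)

end KripkeModel

/-! ### The category of interpretations and its logical structure -/

namespace KripkeModel

variable {P : Type u} [PartialOrder P] (K : KripkeModel.{v, u} L P)

/-- The chosen formula with the same interpretation in context as `φ`. -/
def rep (φ : LForm L) : LForm L :=
  (Quotient.mk (Setoid.ker K.toToposModel.sem) φ).out

theorem sem_rep (φ : LForm L) : K.toToposModel.sem (K.rep φ) = K.toToposModel.sem φ :=
  Quotient.mk_out (s := Setoid.ker K.toToposModel.sem) φ

theorem rep_eq_rep_iff {φ ψ : LForm L} :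
    K.rep φ = K.rep ψ ↔ K.toToposModel.sem φ = K.toToposModel.sem ψ := by
  constructor
  · intro h
    rw [← sem_rep, h, sem_rep]
  · intro h
    exact congrArg Quotient.out (Quotient.sound (s := Setoid.ker K.toToposModel.sem) h)

/-- The objects of the category associated with the Kripke model: interpretations of formulae,
each one given by a chosen formula. -/
def ldObj : Set (LForm L) := Set.range K.rep

/-- The object given by a formula. -/
def ldN (φ : LForm L) : K.ldObj := ⟨K.rep φ, φ, rfl⟩

/-- An arrow is a proof that an implication is valid. -/
instance : Category.{v} K.ldObj where
  Hom X Y := ULift (PLift (K.Valid (.imp X.1 Y.1)))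
  id _ := ⟨⟨K.valid_imp.2 fun _ _ h => h⟩⟩
  comp f g := ⟨⟨K.valid_imp.2 fun p w h =>
    K.valid_imp.1 g.down.down p w (K.valid_imp.1 f.down.down p w h)⟩⟩

variable {K}

instance (X Y : K.ldObj) : Subsingleton (X ⟶ Y) :=
  inferInstanceAs (Subsingleton (ULift (PLift (K.Valid (.imp X.1 Y.1)))))

theorem holds_of_hom {X Y : K.ldObj} (f : X ⟶ Y) {p : P} {w : (K.model p).Assignment}
    (h : K.Holds p w X.1) : K.Holds p w Y.1 :=
  K.valid_imp.1 f.down.down p w h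

/-- The arrow given by a semantic entailment. -/
def homOfHolds {X Y : K.ldObj}
    (h : ∀ (p : P) (w : (K.model p).Assignment), K.Holds p w X.1 → K.Holds p w Y.1) : X ⟶ Y :=
  ⟨⟨K.valid_imp.2 h⟩⟩

theorem holds_ldN {φ : LForm L} {p : P} {w : (K.model p).Assignment} :
    K.Holds p w (K.ldN φ).1 ↔ K.Holds p w φ :=
  K.holds_congr_of_sem_eq (K.sem_rep φ) w

theorem isIso_of_hom {X Y : K.ldObj} (f : X ⟶ Y) (g : Y ⟶ X) : IsIso f :=
  ⟨g, Subsingleton.elim _ _, Subsingleton.elim _ _⟩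

variable (K)

/-- The object of the true formula is terminal. -/
def isTerminalTop : IsTerminal (K.ldN .top) :=
  IsTerminal.ofUniqueHom (fun _ => homOfHolds fun _ _ _ => holds_ldN.2 trivial)
    fun _ _ => Subsingleton.elim _ _

/-- The object of the false formula is initial. -/
def isInitialBot : IsInitial (K.ldN .bot) :=
  IsInitial.ofUniqueHom (fun _ => homOfHolds fun _ _ h => (holds_ldN.1 h).elim)
    fun _ _ => Subsingleton.elim _ _

variable {K}

/-- A fan is a product when its vertex holds as soon as both components do. -/
def isLimitOfHolds {X Y Z : K.ldObj} (f : Z ⟶ X) (g : Z ⟶ Y)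
    (h : ∀ (p : P) (w : (K.model p).Assignment),
      K.Holds p w X.1 → K.Holds p w Y.1 → K.Holds p w Z.1) : IsLimit (BinaryFan.mk f g) :=
  BinaryFan.isLimitMk
    (fun s => homOfHolds fun p w hs => h p w (holds_of_hom s.fst hs) (holds_of_hom s.snd hs))
    (fun _ => Subsingleton.elim _ _) (fun _ => Subsingleton.elim _ _)
    fun _ _ _ _ => Subsingleton.elim _ _

/-- A cofan is a coproduct when one of the components holds as soon as its vertex does. -/
def isColimitOfHolds {X Y Z : K.ldObj} (f : X ⟶ Z) (g : Y ⟶ Z)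
    (h : ∀ (p : P) (w : (K.model p).Assignment),
      K.Holds p w Z.1 → K.Holds p w X.1 ∨ K.Holds p w Y.1) : IsColimit (BinaryCofan.mk f g) :=
  BinaryCofan.isColimitMk
    (fun s => homOfHolds fun p w hz => (h p w hz).elim (holds_of_hom s.inl) (holds_of_hom s.inr))
    (fun _ => Subsingleton.elim _ _) (fun _ => Subsingleton.elim _ _)
    fun _ _ _ _ => Subsingleton.elim _ _

variable (K) in
instance hasFiniteProducts_ldObj : HasFiniteProducts K.ldObj := by
  have : HasTerminal K.ldObj := K.isTerminalTop.hasTerminal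
  have : ∀ X Y : K.ldObj, HasLimit (pair X Y) := fun X Y =>
    ⟨⟨⟨_, isLimitOfHolds (Z := K.ldN (.and X.1 Y.1))
      (homOfHolds fun _ _ h => (holds_ldN.1 h).1) (homOfHolds fun _ _ h => (holds_ldN.1 h).2)
      fun _ _ hX hY => holds_ldN.2 ⟨hX, hY⟩⟩⟩⟩
  have : HasBinaryProducts K.ldObj := hasBinaryProducts_of_hasLimit_pair _
  exact hasFiniteProducts_of_has_binary_and_terminal

variable (K) in
instance hasFiniteCoproducts_ldObj : HasFiniteCoproducts K.ldObj := by
  have : HasInitial K.ldObj := K.isInitialBot.hasInitial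
  have : ∀ X Y : K.ldObj, HasColimit (pair X Y) := fun X Y =>
    ⟨⟨⟨_, isColimitOfHolds (Z := K.ldN (.or X.1 Y.1))
      (homOfHolds fun _ _ h => holds_ldN.2 (Or.inl h))
      (homOfHolds fun _ _ h => holds_ldN.2 (Or.inr h))
      fun _ _ h => holds_ldN.1 h⟩⟩⟩
  have : HasBinaryCoproducts K.ldObj := hasBinaryCoproducts_of_hasColimit_pair _
  exact hasFiniteCoproducts_of_has_binary_and_initial

/-- The categorical product is an unspecified choice; the arrow into it from the object of the
conjunction identifies its forcing condition. -/
theorem holds_prod {X Y : K.ldObj} {p : P} {w : (K.model p).Assignment} :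
    K.Holds p w (X ⨯ Y).1 ↔ K.Holds p w X.1 ∧ K.Holds p w Y.1 := by
  constructor
  · exact fun h => ⟨holds_of_hom prod.fst h, holds_of_hom prod.snd h⟩
  · intro h
    let f : K.ldN (.and X.1 Y.1) ⟶ X := homOfHolds fun _ _ h => (holds_ldN.1 h).1
    let g : K.ldN (.and X.1 Y.1) ⟶ Y := homOfHolds fun _ _ h => (holds_ldN.1 h).2
    exact holds_of_hom (prod.lift f g) (holds_ldN.2 h)

theorem holds_coprod {X Y : K.ldObj} {p : P} {w : (K.model p).Assignment} :
    K.Holds p w (X ⨿ Y).1 ↔ K.Holds p w X.1 ∨ K.Holds p w Y.1 := by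
  constructor
  · intro h
    let f : X ⟶ K.ldN (.or X.1 Y.1) := homOfHolds fun _ _ h => holds_ldN.2 (Or.inl h)
    let g : Y ⟶ K.ldN (.or X.1 Y.1) := homOfHolds fun _ _ h => holds_ldN.2 (Or.inr h)
    exact holds_ldN.1 (holds_of_hom (coprod.desc f g) h)
  · rintro (h | h)
    · exact holds_of_hom coprod.inl h
    · exact holds_of_hom coprod.inr h

/-- A transpose must yield the implication at all later stages, where persistence keeps its domain
forced. That `E` entails the implication is already contained in `ev`. -/
theorem isExponential_of_holds {X Y E : K.ldObj} (ev : X ⨯ E ⟶ Y)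
    (hE : ∀ (p : P) (w : (K.model p).Assignment),
      K.Holds p w (.imp X.1 Y.1) → K.Holds p w E.1) : IsExponential ev := fun _ f =>
  ⟨homOfHolds fun p w hZ => hE p w <| K.holds_imp.2 fun _ h hX =>
    holds_of_hom f (holds_prod.2 ⟨hX, hZ.mono h⟩), Subsingleton.elim _ _,
    fun _ _ => Subsingleton.elim _ _⟩

theorem holds_imp_mp {p : P} {w : (K.model p).Assignment} {A B : LForm L}
    (h : K.Holds p w (.imp A B)) (hA : K.Holds p w A) : K.Holds p w B := by
  have := K.holds_imp.1 h p le_rfl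
  simp only [K.map_refl] at this
  exact this hA

theorem holds_inst_of_allV {p : P} {w : (K.model p).Assignment} {A : LForm L} {x : L.Var}
    (t : LTerm L x.1) (h : K.Holds p w (A.allV x)) : K.Holds p w (A.inst x t) := by
  have := K.holds_allV.1 h p le_rfl
  simp only [K.map_refl] at this
  exact K.holds_inst.2 (this _)

open scoped Classical in
-- The variable `x` serves as the generic term, whose value can be any element.
theorem holds_inst_free {p : P} {w : (K.model p).Assignment} {A : LForm L} {x : L.Var} :
    K.Holds p w (A.inst x (.free x)) ↔ K.Holds p w A := by
  rw [holds_inst]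
  exact iff_of_eq (congrArg (fun w => K.Holds p w A) (Function.update_eq_self x w))

theorem holds_imp_ldN {p : P} {w : (K.model p).Assignment} {A B : LForm L} :
    K.Holds p w (.imp (K.ldN A).1 (K.ldN B).1) ↔ K.Holds p w (.imp A B) := by
  simp only [holds_imp, holds_ldN]

variable (K)

/-- The category associated with a Kripke model is logically distributive. -/
def logicallyDistributive_ldObj : LogicallyDistributive (L := L) K.ldObj K.ldN where
  exponentials A B :=
    ⟨K.ldN (.imp A.1 B.1), homOfHolds fun p w h =>
      holds_imp_mp (holds_ldN.1 (holds_prod.1 h).2) (holds_prod.1 h).1,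
      isExponential_of_holds _ fun _ _ h => holds_ldN.2 h⟩
  distributive A B B' := isIso_of_hom _ <| homOfHolds fun p w h => by
    obtain ⟨hA, hB⟩ := holds_prod.1 h
    exact holds_coprod.2 ((holds_coprod.1 hB).imp (fun h => holds_prod.2 ⟨hA, h⟩)
      fun h => holds_prod.2 ⟨hA, h⟩)
  zero := K.isInitialBot
  one := K.isTerminalTop
  fst A B := homOfHolds fun _ _ h => holds_ldN.2 (holds_ldN.1 h).1
  snd A B := homOfHolds fun _ _ h => holds_ldN.2 (holds_ldN.1 h).2
  isProduct A B := isLimitOfHolds _ _ fun _ _ hA hB =>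
    holds_ldN.2 ⟨holds_ldN.1 hA, holds_ldN.1 hB⟩
  inl A B := homOfHolds fun _ _ h => holds_ldN.2 (Or.inl (holds_ldN.1 h))
  inr A B := homOfHolds fun _ _ h => holds_ldN.2 (Or.inr (holds_ldN.1 h))
  isCoproduct A B := isColimitOfHolds _ _ fun _ _ h =>
    (holds_ldN.1 h).imp holds_ldN.2 holds_ldN.2
  ev A B := homOfHolds fun p w h => holds_ldN.2 <|
    holds_imp_mp (holds_ldN.1 (holds_prod.1 h).2) (holds_ldN.1 (holds_prod.1 h).1)
  isExponential A B := isExponential_of_holds _ fun _ _ h => holds_ldN.2 (holds_imp_ldN.1 h)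
  allE x A t := homOfHolds fun _ _ h => holds_ldN.2 (holds_inst_of_allV t (holds_ldN.1 h))
  isTerminalAll x A B hx c := by
    classical
    refine ⟨homOfHolds fun p w h => holds_ldN.2 (K.holds_allV.2 fun q hq a => ?_),
      fun _ => Subsingleton.elim _ _, fun _ _ => Subsingleton.elim _ _⟩
    -- `B` persists to `q` and ignores the value of `x`, so `x` may be given the value `a`; the
    -- component of the cone at the term `x` then yields `A` at `a`.
    have hB := (K.holds_update_of_notMem hx a).2 ((holds_ldN.1 h).mono hq)
    exact holds_inst_free.1 (holds_ldN.1 (holds_of_hom (c (.free x)) (holds_ldN.2 hB)))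
  exI x A t := homOfHolds fun _ _ h =>
    holds_ldN.2 (K.holds_exV.2 ⟨_, K.holds_inst.1 (holds_ldN.1 h)⟩)
  isInitialEx x A B hx c := by
    classical
    refine ⟨homOfHolds fun p w h => holds_ldN.2 ?_,
      fun _ => Subsingleton.elim _ _, fun _ _ => Subsingleton.elim _ _⟩
    obtain ⟨a, ha⟩ := K.holds_exV.1 (holds_ldN.1 h)
    -- The component at the term `x` is used with `x` sent to the witness `a`; its conclusion `B`
    -- does not depend on that value.
    exact (K.holds_update_of_notMem hx a).1
      (holds_ldN.1 (holds_of_hom (c (.free x)) (holds_ldN.2 (holds_inst_free.2 ha))))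
  frobenius x A B hx := by
    classical
    refine ⟨homOfHolds fun p w h => holds_ldN.2 ?_,
      fun t => ⟨Subsingleton.elim _ _, Subsingleton.elim _ _⟩,
      isIso_of_hom _ (homOfHolds fun p w h => holds_ldN.2 ?_)⟩
    · obtain ⟨a, hA, hB⟩ := K.holds_exV.1 (holds_ldN.1 h)
      exact ⟨(K.holds_update_of_notMem hx a).1 hA, K.holds_exV.2 ⟨a, hB⟩⟩
    · obtain ⟨hA, hB⟩ := holds_ldN.1 h
      obtain ⟨a, ha⟩ := K.holds_exV.1 hB
      exact K.holds_exV.2 ⟨a, (K.holds_update_of_notMem hx a).2 hA, ha⟩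

/-- The category associated with the topos model of a Kripke model. -/
def ld : SigmaStr L where
  Obj := K.ldObj
  N := K.ldN
  surjective := by
    rintro ⟨_, φ, rfl⟩
    exact ⟨φ, rfl⟩
  logicallyDistributive := K.logicallyDistributive_ldObj

theorem nonempty_hom_iff {X Y : K.ldObj} : Nonempty (X ⟶ Y) ↔
    ∀ (p : P) (w : (K.model p).Assignment), K.Holds p w X.1 → K.Holds p w Y.1 :=
  ⟨fun ⟨f⟩ _ _ => holds_of_hom f, fun h => ⟨homOfHolds h⟩⟩

theorem isLD_ld : K.ld.IsLD K.toToposModel where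
  obj_eq_iff φ ψ := Subtype.ext_iff.trans K.rep_eq_rep_iff
  subsingleton_hom X Y := inferInstanceAs (Subsingleton (ULift (PLift (K.Valid (.imp X.1 Y.1)))))
  nonempty_hom_iff φ ψ := by
    refine K.nonempty_hom_iff.trans ?_
    rw [validates_iff, valid_imp]
    exact forall_congr' fun p => forall_congr' fun w => imp_congr holds_ldN holds_ldN

theorem valid_ld_iff (φ : LForm L) : K.ld.Valid φ ↔ K.Valid φ := by
  constructor
  · rintro ⟨f⟩ p w
    -- The chosen terminal object is opaque, so it is reached from the object of `⊤`, which is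
    -- forced everywhere.
    exact holds_ldN.1 (holds_of_hom (K := K) (terminal.from (K.ldN .top) ≫ f)
      (holds_ldN.2 trivial))
  · intro h
    exact ⟨homOfHolds (K := K) fun p w _ => holds_ldN.2 (h p w)⟩

end KripkeModel

end LogDist

end

theorem proposition11p3 (L : LogDist.Signature.{v}) (P : Type u) [PartialOrder P]
    (K : LogDist.KripkeModel.{v, u} L P) :
    ∃ D : LogDist.SigmaStr L,
      D.IsLD K.toToposModel ∧
        ∀ φ : LogDist.LForm L, K.Valid φ ↔ D.Valid φ :=
  ⟨K.ld, K.isLD_ld, fun φ => (K.valid_ld_iff φ).symm⟩
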